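/- Let $\mathbb H$ be the skew field of real quaternions and let $\mathbb H[[z]]$ be the ring of formal power series $f(z)=\sum_{k\ge 0} z^k f_k$, $f_k\in\mathbb H$, in a variable $z$ commuting with the coefficients. Let $\mathcal H_1$ be the set of all $f\in\mathbb H[[z]]$ with $\limsup_{k\to\infty}|f_k|^{1/k}\le 1$; for $f\in\mathcal H_1$ and $\gamma\in\mathbb H$ with $|\gamma|<1$ put $f^{\boldsymbol{e_\ell}}(\gamma)=\sum_{k\ge0}\gamma^k f_k$ and $f^{\boldsymbol{e_r}}(\gamma)=\sum_{k\ge0}f_k\gamma^k$. For $\alpha\in\mathbb H$ with $|\alpha|<1$ let $\mathbf b_\alpha(z)=(z-\alpha)\sum_{k\ge0}\overline{\alpha}^k z^k$. A finite Blaschke product is a power series of the form $\mathbf b_{\alpha_1}\mathbf b_{\alpha_2}\cdots\mathbf b_{\alpha_n}\phi$ with $n\ge 0$, $\alpha_1,\dots,\alpha_n,\phi\in\mathbb H$, $|\alpha_i|<1$ for all $i$, and $|\phi|=1$. Theorem. Let $f\in\mathcal H_1$. If $$\lim_{|\gamma|\to1^-}|f^{\boldsymbol{e_\ell}}(\gamma)|=1,$$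 then $f$ is a finite Blaschke product. Moreover, this condition holds if and only if $$\lim_{|\gamma|\to1^-}|f^{\boldsymbol{e_r}}(\gamma)|=1.$$ Here $\lim_{|\gamma|\to 1^-}F(\gamma)=1$ means that for every $\varepsilon>0$ there is $\delta>0$ such that $|F(\gamma)-1|<\varepsilon$ for all $\gamma\in\mathbb H$ with $1-\delta<|\gamma|<1$. -/

import Mathlib

open Filter Topology
open scoped ENNReal Quaternion

noncomputable section

namespace QuaternionicBlaschke

/-- The class `𝓗_R` of quaternionic power series `∑ zᵏ f_k` (the variable commutes with the
coefficients) with `limsup_k |f_k|^{1/k} ≤ 1/R`. -/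
def powerSeriesClass (R : ℝ≥0∞) : Set (PowerSeries ℍ[ℝ]) :=
  {f | limsup (fun k : ℕ => ‖PowerSeries.coeff k f‖ₑ ^ (1 / (k : ℝ))) atTop ≤ R⁻¹}

/-- Left evaluation `∑ γᵏ f_k`. -/
def leftEval (f : PowerSeries ℍ[ℝ]) (γ : ℍ[ℝ]) : ℍ[ℝ] :=
  ∑' k : ℕ, γ ^ k * PowerSeries.coeff k f

/-- Right evaluation `∑ f_k γᵏ`. -/
def rightEval (f : PowerSeries ℍ[ℝ]) (γ : ℍ[ℝ]) : ℍ[ℝ] :=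
  ∑' k : ℕ, PowerSeries.coeff k f * γ ^ k

/-- For `f ∈ 𝓗_R` and `|γ| < R` the terms of the evaluation series are dominated by a convergent
geometric series. -/
theorem summable_norm_eval {R : ℝ≥0∞} {f : PowerSeries ℍ[ℝ]} (hf : f ∈ powerSeriesClass R)
    {γ : ℍ[ℝ]} (hγ : ‖γ‖ₑ < R) :
    Summable fun k : ℕ => ‖γ‖ ^ k * ‖PowerSeries.coeff k f‖ := by
  obtain ⟨r, hγr, hrR⟩ := ENNReal.lt_iff_exists_nnreal_btwn.1 hγ
  have hlt : limsup (fun k : ℕ => ‖PowerSeries.coeff k f‖ₑ ^ (1 / (k : ℝ))) atTop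
      < (r : ℝ≥0∞)⁻¹ := lt_of_le_of_lt hf (ENNReal.inv_lt_inv.2 hrR)
  have hr0 : r ≠ 0 := by
    rintro rfl
    simp at hγr
  have hγr' : ‖γ‖₊ < r := by
    rw [enorm_eq_nnnorm] at hγr
    exact_mod_cast hγr
  have hrpos : (0 : ℝ) < r := by
    exact_mod_cast pos_iff_ne_zero.2 hr0
  have hev := eventually_lt_of_limsup_lt hlt
  have hq : ‖γ‖ / (r : ℝ) < 1 := by
    rw [div_lt_one hrpos]
    exact_mod_cast hγr'
  refine Summable.of_norm_bounded_eventually_nat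
    (summable_geometric_of_lt_one (by positivity) hq) ?_
  filter_upwards [hev, eventually_ge_atTop 1] with k hk hk1
  have hkpos : (0 : ℝ) < k := by exact_mod_cast hk1
  have h1 : ‖PowerSeries.coeff k f‖₊ ≤ (r⁻¹) ^ k := by
    have h2 := ENNReal.rpow_le_rpow hk.le hkpos.le
    rw [← ENNReal.rpow_mul, one_div, inv_mul_cancel₀ hkpos.ne', ENNReal.rpow_one,
      ENNReal.rpow_natCast, enorm_eq_nnnorm, ← ENNReal.coe_inv hr0] at h2
    exact_mod_cast h2
  have h3 : ‖PowerSeries.coeff k f‖ ≤ ((r : ℝ)⁻¹) ^ k := by exact_mod_cast h1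
  rw [Real.norm_of_nonneg (by positivity), div_eq_mul_inv, mul_pow]
  gcongr

/-- The left evaluation series of `f ∈ 𝓗_R` converges at every `|γ| < R`. -/
theorem summable_leftEval {R : ℝ≥0∞} {f : PowerSeries ℍ[ℝ]} (hf : f ∈ powerSeriesClass R)
    {γ : ℍ[ℝ]} (hγ : ‖γ‖ₑ < R) :
    Summable fun k : ℕ => γ ^ k * PowerSeries.coeff k f :=
  Summable.of_norm (by simpa [norm_mul, norm_pow] using summable_norm_eval hf hγ)

/-- The right evaluation series of `f ∈ 𝓗_R` converges at every `|γ| < R`. -/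
theorem summable_rightEval {R : ℝ≥0∞} {f : PowerSeries ℍ[ℝ]} (hf : f ∈ powerSeriesClass R)
    {γ : ℍ[ℝ]} (hγ : ‖γ‖ₑ < R) :
    Summable fun k : ℕ => PowerSeries.coeff k f * γ ^ k :=
  Summable.of_norm (by simpa [norm_mul, norm_pow, mul_comm] using summable_norm_eval hf hγ)

/-- The Blaschke factor `𝐛_α(z) = (z - α) ∑ ᾱᵏ zᵏ = (z - α)(1 - z ᾱ)⁻¹`. -/
def blaschkeFactor (α : ℍ[ℝ]) : PowerSeries ℍ[ℝ] :=
  (PowerSeries.X - PowerSeries.C α) * PowerSeries.mk fun k => star α ^ k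

/-- Finite Blaschke products `𝐛_{α₁} ⋯ 𝐛_{αₙ} φ` with `|α_i| < 1`, `|φ| = 1` and `n ≥ 0`; the
product is the ordered one. -/
def IsFiniteBlaschkeProduct (f : PowerSeries ℍ[ℝ]) : Prop :=
  ∃ (l : List ℍ[ℝ]) (φ : ℍ[ℝ]), (∀ α ∈ l, ‖α‖ < 1) ∧ ‖φ‖ = 1 ∧
    f = (l.map blaschkeFactor).prod * PowerSeries.C φ

/-- The filter `|γ| → 1⁻` on the quaternions: the limit is uniform over directions, and all
points considered satisfy `|γ| < 1`. -/
def normToOneLeft : Filter ℍ[ℝ] := comap (fun γ : ℍ[ℝ] => ‖γ‖) (𝓝[<] 1)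

end QuaternionicBlaschke

end

/-! Call `f` inner if its left evaluation has modulus tending to 1 at the sphere. Left evaluation is
multiplicative up to conjugating the point of the second factor (`leftEval_mul`). Conjugation
preserves norms, so products of inner series are inner.

A zero `α` of an inner `f` splits off as `f = 𝐛_α h`. Multiplying by `𝐛_ᾱ` on the left makes `𝐛_ᾱ
𝐛_α` central, so evaluation no longer twists and `h` is again inner
(`IsLeftInner.exists_eq_blaschkeFactor_mul`). Zeros lie in some `|γ| < r < 1`, so each division
multiplies `|f_0|` by more than `1/r`; zeros at the origin are removed first.

Extremal principles come from the holomorphic map `F(z) = ∑ zᵏ f_k` into `ℂ⁴`: `|F(z)|` and `|∑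
F_j(z)²|` are governed by `f` at two points of norm `|z|` (`DiscSummable.exists_conjugates`). Hence
a zero-free inner series has `|f_0| ≥ 1`, and this forces it to be a unimodular constant.

For right evaluation, conjugating the coefficients exchanges the two sides and carries finite
Blaschke products to inner series. -/

noncomputable section

namespace QuaternionicBlaschke

/-! ### Absolute convergence on the unit ball -/

/-- Power series converging absolutely, together with all evaluations, on the open unit ball. -/
def DiscSummable (f : PowerSeries ℍ[ℝ]) : Prop :=
  ∀ r : ℝ, 0 ≤ r → r < 1 → Summable fun k : ℕ => r ^ k * ‖PowerSeries.coeff k f‖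

theorem discSummable_of_mem {f : PowerSeries ℍ[ℝ]} (hf : f ∈ powerSeriesClass 1) :
    DiscSummable f := by
  intro r hr0 hr1
  have hn : ‖((r : ℝ) : ℍ[ℝ])‖ = r := by
    rw [Quaternion.norm_coe, Real.norm_of_nonneg hr0]
  have h := summable_norm_eval hf (γ := (r : ℍ[ℝ])) (by
    rw [← ofReal_norm, hn, ← ENNReal.ofReal_one]
    exact (ENNReal.ofReal_lt_ofReal_iff one_pos).2 hr1)
  rwa [hn] at h

theorem DiscSummable.summable_leftEval {f : PowerSeries ℍ[ℝ]} (hf : DiscSummable f) {γ : ℍ[ℝ]}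
    (hγ : ‖γ‖ < 1) : Summable fun k : ℕ => γ ^ k * PowerSeries.coeff k f :=
  Summable.of_norm (by simpa [norm_mul, norm_pow] using hf ‖γ‖ (norm_nonneg _) hγ)

theorem DiscSummable.mul {f g : PowerSeries ℍ[ℝ]} (hf : DiscSummable f) (hg : DiscSummable g) :
    DiscSummable (f * g) := by
  intro r hr0 hr1
  have h := summable_sum_mul_antidiagonal_of_summable_mul
    (Summable.mul_of_nonneg (hf r hr0 hr1) (hg r hr0 hr1) (fun k => by positivity)
      (fun k => by positivity))
  refine Summable.of_nonneg_of_le (fun k => by positivity) (fun k => ?_) h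
  rw [PowerSeries.coeff_mul]
  calc r ^ k * ‖∑ p ∈ Finset.HasAntidiagonal.antidiagonal k,
          PowerSeries.coeff p.1 f * PowerSeries.coeff p.2 g‖
      ≤ r ^ k * ∑ p ∈ Finset.HasAntidiagonal.antidiagonal k,
          ‖PowerSeries.coeff p.1 f‖ * ‖PowerSeries.coeff p.2 g‖ := by
        gcongr
        refine (norm_sum_le _ _).trans (le_of_eq ?_)
        exact Finset.sum_congr rfl fun p _ => norm_mul _ _
    _ = _ := by
        rw [Finset.mul_sum]
        refine Finset.sum_congr rfl fun p hp => ?_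
        rw [← Finset.HasAntidiagonal.mem_antidiagonal.1 hp, pow_add]
        ring

theorem DiscSummable.sub {f g : PowerSeries ℍ[ℝ]} (hf : DiscSummable f) (hg : DiscSummable g) :
    DiscSummable (f - g) := by
  intro r hr0 hr1
  refine Summable.of_nonneg_of_le (fun k => by positivity) (fun k => ?_)
    ((hf r hr0 hr1).add (hg r hr0 hr1))
  rw [map_sub, ← mul_add]
  gcongr
  exact norm_sub_le _ _

theorem discSummable_C (a : ℍ[ℝ]) : DiscSummable (PowerSeries.C a) := by
  intro r _ _
  refine summable_of_ne_finset_zero (s := {0}) fun k hk => ?_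
  simp at hk
  simp [PowerSeries.coeff_C, hk]

theorem discSummable_one : DiscSummable 1 := by
  simpa using discSummable_C 1

theorem discSummable_X : DiscSummable (PowerSeries.X : PowerSeries ℍ[ℝ]) := by
  intro r _ _
  refine summable_of_ne_finset_zero (s := {1}) fun k hk => ?_
  simp at hk
  simp [PowerSeries.coeff_X, hk]

theorem discSummable_geometric {a : ℍ[ℝ]} (ha : ‖a‖ < 1) :
    DiscSummable (PowerSeries.mk fun k => a ^ k) := by
  intro r hr0 hr1
  simp only [PowerSeries.coeff_mk, norm_pow, ← mul_pow]
  exact summable_geometric_of_lt_one (by positivity) (by nlinarith [norm_nonneg a])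

theorem discSummable_blaschkeFactor {α : ℍ[ℝ]} (hα : ‖α‖ < 1) :
    DiscSummable (blaschkeFactor α) :=
  (discSummable_X.sub (discSummable_C α)).mul (discSummable_geometric (by simpa using hα))

/-! ### Evaluation of products -/

/-- The conjugate of `γ` by which the second factor of `p * h` is evaluated. -/
def twist (p : PowerSeries ℍ[ℝ]) (γ : ℍ[ℝ]) : ℍ[ℝ] :=
  open Classical in
  if leftEval p γ = 0 then γ else (leftEval p γ)⁻¹ * γ * leftEval p γ

theorem norm_twist (p : PowerSeries ℍ[ℝ]) (γ : ℍ[ℝ]) : ‖twist p γ‖ = ‖γ‖ := by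
  unfold twist
  split_ifs with h
  · rfl
  · have : ‖leftEval p γ‖ ≠ 0 := norm_ne_zero_iff.2 h
    rw [norm_mul, norm_mul, norm_inv]
    field_simp

theorem twist_of_commute {p : PowerSeries ℍ[ℝ]} {γ : ℍ[ℝ]} (h : Commute γ (leftEval p γ)) :
    twist p γ = γ := by
  unfold twist
  split_ifs with h0
  · rfl
  · rw [mul_assoc, h.eq, inv_mul_cancel_left₀ h0]

theorem leftEval_mul_eq_tsum {p h : PowerSeries ℍ[ℝ]} (hp : DiscSummable p) (hh : DiscSummable h)
    {γ : ℍ[ℝ]} (hγ : ‖γ‖ < 1) :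
    leftEval (p * h) γ = ∑' j, γ ^ j * leftEval p γ * PowerSeries.coeff j h := by
  set F : ℕ × ℕ → ℍ[ℝ] := fun x =>
    γ ^ x.2 * (γ ^ x.1 * PowerSeries.coeff x.1 p) * PowerSeries.coeff x.2 h with hF
  have hs : Summable F := by
    apply Summable.of_norm
    have h1 := Summable.mul_of_nonneg (hp ‖γ‖ (norm_nonneg _) hγ) (hh ‖γ‖ (norm_nonneg _) hγ)
      (fun k => by positivity) (fun k => by positivity)
    refine h1.congr fun x => ?_
    simp only [hF, norm_mul, norm_pow]
    ring
  have hs' : Summable fun x : ℕ × ℕ => F x.swap := (Equiv.prodComm ℕ ℕ).summable_iff.2 hs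
  have e1 : ∑' x, F x = leftEval (p * h) γ := by
    have hσ : Summable fun x => F (Finset.HasAntidiagonal.sigmaAntidiagonalEquivProd x) :=
      Finset.HasAntidiagonal.sigmaAntidiagonalEquivProd.summable_iff.2 hs
    rw [← Finset.HasAntidiagonal.sigmaAntidiagonalEquivProd.tsum_eq F,
      hσ.tsum_sigma' (fun n => Summable.of_finite)]
    refine tsum_congr fun n => ?_
    rw [tsum_fintype, PowerSeries.coeff_mul, Finset.mul_sum,
      ← Finset.sum_coe_sort (Finset.HasAntidiagonal.antidiagonal n)]
    refine Finset.sum_congr rfl fun x _ => ?_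
    have hx := Finset.HasAntidiagonal.mem_antidiagonal.1 x.2
    simp only [hF, Finset.HasAntidiagonal.sigmaAntidiagonalEquivProd_apply]
    have hγn : γ ^ n = γ ^ x.1.2 * γ ^ x.1.1 := by rw [← pow_add, add_comm, hx]
    rw [hγn]
    simp only [mul_assoc]
  have e2 : ∑' x, F x = ∑' j, γ ^ j * leftEval p γ * PowerSeries.coeff j h := by
    rw [← (Equiv.prodComm ℕ ℕ).tsum_eq F]
    have : Summable fun x : ℕ × ℕ => F (Equiv.prodComm ℕ ℕ x) := hs'
    have hi : ∀ j, Summable fun i => F (i, j) := fun j =>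
      ((hp.summable_leftEval hγ).mul_left (γ ^ j)).mul_right (PowerSeries.coeff j h)
    rw [this.tsum_prod' hi]
    refine tsum_congr fun j => ?_
    simp only [Equiv.prodComm_apply, Prod.swap, hF]
    rw [((hp.summable_leftEval hγ).mul_left (γ ^ j)).tsum_mul_right,
      (hp.summable_leftEval hγ).tsum_mul_left]
    rfl
  rw [← e1, e2]

/-- Where `p(γ) ≠ 0`, moving `γ ^ j` to the right past `p(γ)` conjugates it: `γ ^ j p(γ) = p(γ)
(p(γ)⁻¹ γ p(γ)) ^ j`. -/
theorem leftEval_mul {p h : PowerSeries ℍ[ℝ]} (hp : DiscSummable p) (hh : DiscSummable h)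
    {γ : ℍ[ℝ]} (hγ : ‖γ‖ < 1) :
    leftEval (p * h) γ = leftEval p γ * leftEval h (twist p γ) := by
  rw [leftEval_mul_eq_tsum hp hh hγ]
  by_cases h0 : leftEval p γ = 0
  · simp [h0]
  · rw [leftEval.eq_def h, ← (hh.summable_leftEval (by rwa [norm_twist])).tsum_mul_left]
    refine tsum_congr fun j => ?_
    rw [twist, if_neg h0]
    have : ((leftEval p γ)⁻¹ * γ * leftEval p γ) ^ j
        = (leftEval p γ)⁻¹ * γ ^ j * leftEval p γ := by
      induction j with
      | zero => simp [h0]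
      | succ n ih =>
        rw [pow_succ, ih, pow_succ]
        simp only [mul_assoc]
        rw [mul_inv_cancel_left₀ h0]
    rw [this]
    simp only [← mul_assoc]
    rw [mul_inv_cancel₀ h0, one_mul]

theorem leftEval_sub {f g : PowerSeries ℍ[ℝ]} (hf : DiscSummable f) (hg : DiscSummable g)
    {γ : ℍ[ℝ]} (hγ : ‖γ‖ < 1) : leftEval (f - g) γ = leftEval f γ - leftEval g γ := by
  simp only [leftEval, map_sub, mul_sub]
  exact (hf.summable_leftEval hγ).tsum_sub (hg.summable_leftEval hγ)

theorem leftEval_C (a γ : ℍ[ℝ]) : leftEval (PowerSeries.C a) γ = a := by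
  rw [leftEval, tsum_eq_single 0 (fun k hk => by simp [PowerSeries.coeff_C, hk])]
  simp

theorem leftEval_X (γ : ℍ[ℝ]) : leftEval PowerSeries.X γ = γ := by
  rw [leftEval, tsum_eq_single 1 (fun k hk => by simp [PowerSeries.coeff_X, hk])]
  simp

theorem leftEval_X_mul_C (a : ℍ[ℝ]) {γ : ℍ[ℝ]} (hγ : ‖γ‖ < 1) :
    leftEval (PowerSeries.X * PowerSeries.C a) γ = γ * a := by
  rw [leftEval_mul discSummable_X (discSummable_C a) hγ, leftEval_X, leftEval_C]

/-! ### Blaschke factors -/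

/-- The denominator `1 - z ᾱ` of the Blaschke factor `𝐛_α`. -/
def blaschkeDenom (α : ℍ[ℝ]) : PowerSeries ℍ[ℝ] := 1 - PowerSeries.X * PowerSeries.C (star α)

theorem discSummable_blaschkeDenom (α : ℍ[ℝ]) : DiscSummable (blaschkeDenom α) :=
  discSummable_one.sub (discSummable_X.mul (discSummable_C _))

theorem leftEval_blaschkeDenom (α : ℍ[ℝ]) {γ : ℍ[ℝ]} (hγ : ‖γ‖ < 1) :
    leftEval (blaschkeDenom α) γ = 1 - γ * star α := by
  rw [blaschkeDenom, leftEval_sub discSummable_one (discSummable_X.mul (discSummable_C _)) hγ,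
    leftEval_X_mul_C _ hγ, ← map_one PowerSeries.C, leftEval_C]

theorem blaschkeDenom_mul_geometric (α : ℍ[ℝ]) :
    blaschkeDenom α * (PowerSeries.mk fun k => star α ^ k) = 1 := by
  ext1 n
  rw [blaschkeDenom, sub_mul, one_mul, mul_assoc, map_sub]
  cases n with
  | zero => simp
  | succ n => simp [PowerSeries.coeff_succ_X_mul, PowerSeries.coeff_one, pow_succ']

theorem geometric_mul_blaschkeDenom (α : ℍ[ℝ]) :
    (PowerSeries.mk fun k => star α ^ k) * blaschkeDenom α = 1 := by
  ext1 n
  rw [blaschkeDenom, mul_sub, mul_one, ← mul_assoc, map_sub, PowerSeries.coeff_mul_C]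
  cases n with
  | zero => simp
  | succ n => simp [PowerSeries.coeff_succ_mul_X, PowerSeries.coeff_one, pow_succ]

theorem commute_X_sub_C_blaschkeDenom {a α : ℍ[ℝ]} (h : Commute a (star α)) :
    Commute (PowerSeries.X - PowerSeries.C a) (blaschkeDenom α) := by
  have h1 : Commute (PowerSeries.C a) (PowerSeries.C (star α)) := by
    rw [Commute, SemiconjBy, ← map_mul, ← map_mul, h.eq]
  have hX : ∀ q : PowerSeries ℍ[ℝ], Commute PowerSeries.X q := fun q =>
    (PowerSeries.commute_X q).symm
  unfold blaschkeDenom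
  refine Commute.sub_left ?_ ?_
  · exact hX _
  · exact (Commute.one_right _).sub_right ((hX _).symm.mul_right h1)

theorem blaschkeDenom_mul_blaschkeFactor (α : ℍ[ℝ]) :
    blaschkeDenom α * blaschkeFactor α = PowerSeries.X - PowerSeries.C α := by
  rw [blaschkeFactor, ← mul_assoc,
    ← (commute_X_sub_C_blaschkeDenom (star_comm_self' α).symm).eq, mul_assoc,
    blaschkeDenom_mul_geometric, mul_one]

/-- Evaluating `(1 - z ᾱ) 𝐛_α = z - α` at `γ` evaluates `𝐛_α` at a conjugate of `γ`; `γ` is chosen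
so that this conjugate is `β`. -/
theorem exists_norm_blaschkeFactor {α β : ℍ[ℝ]} (hα : ‖α‖ < 1) (hβ : ‖β‖ < 1) :
    ∃ γ : ℍ[ℝ], ‖γ‖ = ‖β‖ ∧
      ‖1 - γ * star α‖ * ‖leftEval (blaschkeFactor α) β‖ = ‖γ - α‖ := by
  have hne : ∀ a b : ℍ[ℝ], ‖a‖ < 1 → ‖b‖ < 1 → 1 - a * b ≠ 0 := by
    intro a b ha hb h
    have : ‖a * b‖ = 1 := by rw [← sub_eq_zero.1 h, norm_one]
    rw [norm_mul] at this
    nlinarith [norm_nonneg a, norm_nonneg b]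
  set e : ℍ[ℝ] := 1 - β * α with he
  have he0 : e ≠ 0 := hne _ _ hβ hα
  set γ : ℍ[ℝ] := e⁻¹ * β * e with hγdef
  have hγn : ‖γ‖ = ‖β‖ := by
    have : ‖e‖ ≠ 0 := norm_ne_zero_iff.2 he0
    rw [hγdef, norm_mul, norm_mul, norm_inv]
    field_simp
  have hγ1 : ‖γ‖ < 1 := hγn ▸ hβ
  have hd0 : 1 - γ * star α ≠ 0 := hne _ _ hγ1 (by simpa using hα)
  refine ⟨γ, hγn, ?_⟩
  have h1 := leftEval_mul (discSummable_blaschkeDenom α) (discSummable_blaschkeFactor hα) hγ1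
  rw [blaschkeDenom_mul_blaschkeFactor, leftEval_sub discSummable_X (discSummable_C α) hγ1,
    leftEval_X, leftEval_C] at h1
  have htw : twist (blaschkeDenom α) γ = β := by
    rw [twist, leftEval_blaschkeDenom α hγ1, if_neg hd0]
    rw [mul_assoc, inv_mul_eq_iff_eq_mul₀ hd0]
    have hR : e * (1 - γ * star α) = e - β * e * star α := by
      rw [mul_sub, mul_one, hγdef]
      simp only [← mul_assoc]
      rw [mul_inv_cancel₀ he0, one_mul]
    -- With `d = 1 - γ ᾱ`, the product `e d` equals `1 - 2 Re(α) β + |α|² β²`, a real polynomial in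
    -- `β`. Since `e γ = β e`, this commutation gives `d⁻¹ γ d = β`.
    have hcomm : β * (e - β * e * star α) = (e - β * e * star α) * β := by
      have ha : α + star α = ((2 * α.re : ℝ) : ℍ[ℝ]) := by
        rw [Quaternion.self_add_star]; push_cast; rfl
      have hm : α * star α = ((Quaternion.normSq α : ℝ) : ℍ[ℝ]) := Quaternion.self_mul_star α
      have : e - β * e * star α
          = 1 - β * ((2 * α.re : ℝ) : ℍ[ℝ]) + β * β * ((Quaternion.normSq α : ℝ) : ℍ[ℝ]) := by
        rw [← ha, ← hm, he]; noncomm_ring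
      rw [this]
      have c1 := Quaternion.coe_commutes (2 * α.re) β
      have c2 := Quaternion.coe_commutes (Quaternion.normSq α) β
      simp only [mul_add, mul_sub, add_mul, sub_mul, mul_one, one_mul, mul_assoc, c1, c2]
    apply mul_left_cancel₀ he0
    rw [← mul_assoc e _ β, hR, ← hcomm, ← hR, hγdef]
    simp only [← mul_assoc]
    rw [mul_inv_cancel₀ he0, one_mul]
  rw [htw, leftEval_blaschkeDenom α hγ1] at h1
  rw [h1, norm_mul]

/-! ### Inner series -/

/-- Absolute convergence on the unit ball together with `|f(γ)| → 1` at the unit sphere, for the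
left evaluation. -/
def IsLeftInner (f : PowerSeries ℍ[ℝ]) : Prop :=
  DiscSummable f ∧ Tendsto (fun γ : ℍ[ℝ] => ‖leftEval f γ‖) normToOneLeft (𝓝 (1 : ℝ))

theorem tendsto_normToOneLeft_of_norm_eq {τ : ℍ[ℝ] → ℍ[ℝ]} (h : ∀ γ, ‖τ γ‖ = ‖γ‖) :
    Tendsto τ normToOneLeft normToOneLeft := by
  refine tendsto_comap_iff.2 ?_
  have : (fun γ : ℍ[ℝ] => ‖γ‖) ∘ τ = fun γ => ‖γ‖ := funext h
  rw [this]
  exact tendsto_comap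

theorem eventually_norm_lt_one : ∀ᶠ γ in normToOneLeft, ‖γ‖ < 1 :=
  tendsto_comap.eventually (eventually_mem_nhdsWithin : ∀ᶠ x in 𝓝[<] (1 : ℝ), x ∈ Set.Iio 1)

theorem eventually_normToOneLeft_iff {P : ℍ[ℝ] → Prop} :
    (∀ᶠ γ in normToOneLeft, P γ) ↔
      ∃ r : ℝ, 0 < r ∧ r < 1 ∧ ∀ γ, r ≤ ‖γ‖ → ‖γ‖ < 1 → P γ := by
  constructor
  · intro h
    obtain ⟨t, ht, hP⟩ := mem_comap.1 h
    obtain ⟨l, hl, hlt⟩ := (mem_nhdsLT_iff_exists_Ico_subset).1 ht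
    refine ⟨max l (1 / 2), by positivity, max_lt hl (by norm_num), fun γ h1 h2 => hP ?_⟩
    exact hlt ⟨(le_max_left _ _).trans h1, h2⟩
  · rintro ⟨r, _, hr1, h⟩
    have h1 : ∀ᶠ γ in normToOneLeft, r ≤ ‖γ‖ :=
      (tendsto_comap.mono_right nhdsWithin_le_nhds).eventually (eventually_ge_nhds hr1)
    filter_upwards [h1, eventually_norm_lt_one] with γ ha hb using h γ ha hb

theorem IsLeftInner.mul {f g : PowerSeries ℍ[ℝ]} (hf : IsLeftInner f) (hg : IsLeftInner g) :
    IsLeftInner (f * g) := by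
  refine ⟨hf.1.mul hg.1, ?_⟩
  have h := hf.2.mul (hg.2.comp (tendsto_normToOneLeft_of_norm_eq (norm_twist f)))
  rw [one_mul] at h
  refine h.congr' ?_
  filter_upwards [eventually_norm_lt_one] with γ hγ
  rw [leftEval_mul hf.1 hg.1 hγ, norm_mul, Function.comp]

theorem isLeftInner_C {φ : ℍ[ℝ]} (hφ : ‖φ‖ = 1) : IsLeftInner (PowerSeries.C φ) := by
  refine ⟨discSummable_C φ, ?_⟩
  simp only [leftEval_C, hφ]
  exact tendsto_const_nhds

theorem norm_one_sub_mul_star_sq (α γ : ℍ[ℝ]) :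
    ‖1 - γ * star α‖ ^ 2 - ‖γ - α‖ ^ 2 = (1 - ‖γ‖ ^ 2) * (1 - ‖α‖ ^ 2) := by
  simp only [sq, ← Quaternion.normSq_eq_norm_mul_self, Quaternion.normSq_def']
  simp
  ring

theorem one_sub_norm_le (α γ : ℍ[ℝ]) (hγ : ‖γ‖ < 1) : 1 - ‖α‖ ≤ ‖1 - γ * star α‖ := by
  have h := norm_sub_norm_le (1 : ℍ[ℝ]) (γ * star α)
  rw [norm_one, norm_mul, norm_star] at h
  nlinarith [norm_nonneg α]

/-- The squared quotient is `1 - (1 - |γ|²)(1 - |α|²) / |1 - γ ᾱ|²`, whose denominator stays at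
least `(1 - |α|)²`. -/
theorem tendsto_norm_pseudoHyperbolic {α : ℍ[ℝ]} (hα : ‖α‖ < 1) :
    Tendsto (fun γ : ℍ[ℝ] => ‖γ - α‖ / ‖1 - γ * star α‖) normToOneLeft (𝓝 1) := by
  have hpos : 0 < 1 - ‖α‖ := by linarith
  have hn : Tendsto (fun γ : ℍ[ℝ] => ‖γ‖) normToOneLeft (𝓝 1) :=
    tendsto_comap.mono_right nhdsWithin_le_nhds
  have hb : Tendsto (fun γ : ℍ[ℝ] => (1 - ‖γ‖ ^ 2) * (1 - ‖α‖ ^ 2) / (1 - ‖α‖) ^ 2)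
      normToOneLeft (𝓝 0) := by
    have := (((hn.pow 2).const_sub 1).mul_const (1 - ‖α‖ ^ 2)).div_const ((1 - ‖α‖) ^ 2)
    simpa using this
  have h2 : Tendsto (fun γ : ℍ[ℝ] => (‖γ - α‖ / ‖1 - γ * star α‖) ^ 2) normToOneLeft (𝓝 1) := by
    refine tendsto_of_tendsto_of_tendsto_of_le_of_le' (g := fun γ : ℍ[ℝ] =>
      1 - (1 - ‖γ‖ ^ 2) * (1 - ‖α‖ ^ 2) / (1 - ‖α‖) ^ 2) (h := fun _ => 1)
      (by simpa using hb.const_sub 1) tendsto_const_nhds ?_ ?_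
    · filter_upwards [eventually_norm_lt_one] with γ hγ
      have hd := one_sub_norm_le α γ hγ
      have hd0 : 0 < ‖1 - γ * star α‖ := hpos.trans_le hd
      have hnn : 0 ≤ (1 - ‖γ‖ ^ 2) * (1 - ‖α‖ ^ 2) :=
        mul_nonneg (by nlinarith [norm_nonneg γ]) (by nlinarith [norm_nonneg α])
      have e : (‖γ - α‖ / ‖1 - γ * star α‖) ^ 2
          = 1 - (1 - ‖γ‖ ^ 2) * (1 - ‖α‖ ^ 2) / ‖1 - γ * star α‖ ^ 2 := by
        rw [← norm_one_sub_mul_star_sq]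
        field_simp
        ring
      rw [e]
      gcongr
    · filter_upwards [eventually_norm_lt_one] with γ hγ
      have hd0 : 0 < ‖1 - γ * star α‖ := hpos.trans_le (one_sub_norm_le α γ hγ)
      have hnn : 0 ≤ (1 - ‖γ‖ ^ 2) * (1 - ‖α‖ ^ 2) :=
        mul_nonneg (by nlinarith [norm_nonneg γ]) (by nlinarith [norm_nonneg α])
      rw [div_pow, div_le_one (by positivity)]
      linarith [norm_one_sub_mul_star_sq α γ]
  have h3 := h2.sqrt
  rw [Real.sqrt_one] at h3
  refine h3.congr fun γ => ?_
  rw [Real.sqrt_sq (by positivity)]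

theorem isLeftInner_blaschkeFactor {α : ℍ[ℝ]} (hα : ‖α‖ < 1) :
    IsLeftInner (blaschkeFactor α) := by
  refine ⟨discSummable_blaschkeFactor hα, ?_⟩
  have h : ∀ β : ℍ[ℝ], ∃ γ : ℍ[ℝ], ‖γ‖ = ‖β‖ ∧ (‖β‖ < 1 →
      ‖1 - γ * star α‖ * ‖leftEval (blaschkeFactor α) β‖ = ‖γ - α‖) := by
    intro β
    by_cases hβ : ‖β‖ < 1
    · obtain ⟨γ, h1, h2⟩ := exists_norm_blaschkeFactor hα hβ
      exact ⟨γ, h1, fun _ => h2⟩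
    · exact ⟨β, rfl, fun h => absurd h hβ⟩
  choose τ hτ hτ' using h
  refine ((tendsto_norm_pseudoHyperbolic hα).comp (tendsto_normToOneLeft_of_norm_eq hτ)).congr' ?_
  filter_upwards [eventually_norm_lt_one] with β hβ
  have hd := one_sub_norm_le α (τ β) (by rwa [hτ])
  rw [Function.comp, ← hτ' β hβ]
  field_simp [show ‖1 - τ β * star α‖ ≠ 0 by linarith]

theorem leftEval_blaschkeFactor_ne_zero {α β : ℍ[ℝ]} (hα : ‖α‖ < 1) (hβ : ‖β‖ < 1)
    (h : ‖α‖ ≠ ‖β‖) : leftEval (blaschkeFactor α) β ≠ 0 := by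
  intro h0
  obtain ⟨γ, h1, h2⟩ := exists_norm_blaschkeFactor hα hβ
  rw [h0, norm_zero, mul_zero, eq_comm, norm_eq_zero, sub_eq_zero] at h2
  exact h (h2 ▸ h1)

/-! ### Splitting off a zero -/

theorem commute_star_add_self (a α : ℍ[ℝ]) : Commute a (star α + α) := by
  rw [Quaternion.star_add_self']
  exact (Quaternion.coe_commutes _ a).symm

theorem commute_star_mul_self (a α : ℍ[ℝ]) : Commute a (star α * α) := by
  rw [Quaternion.star_mul_self]
  exact (Quaternion.coe_commutes _ a).symm

theorem commute_C {a b : ℍ[ℝ]} (h : Commute a b) :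
    Commute (PowerSeries.C a) (PowerSeries.C b) := h.map PowerSeries.C

theorem isUnit_blaschkeDenom (α : ℍ[ℝ]) : IsUnit (blaschkeDenom α) :=
  ⟨⟨_, _, blaschkeDenom_mul_geometric α, geometric_mul_blaschkeDenom α⟩, rfl⟩

/-- Both `(1 - z ᾱ)(1 - z α)` and `(z - ᾱ)(z - α)` have real coefficients, and the first, a unit,
times `𝐛_ᾱ 𝐛_α` is the second. -/
theorem commute_C_blaschkeFactor_mul (a α : ℍ[ℝ]) :
    Commute (PowerSeries.C a) (blaschkeFactor (star α) * blaschkeFactor α) := by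
  have hX : ∀ q : PowerSeries ℍ[ℝ], q * PowerSeries.X = PowerSeries.X * q := fun q =>
    PowerSeries.X_mul.symm
  have hX' : ∀ q s : PowerSeries ℍ[ℝ], q * (PowerSeries.X * s) = PowerSeries.X * (q * s) :=
    fun q s => by rw [← mul_assoc, hX, mul_assoc]
  have cX : Commute (PowerSeries.C a) PowerSeries.X := PowerSeries.commute_X _
  have hD : blaschkeDenom α * blaschkeDenom (star α) = 1 - PowerSeries.X * PowerSeries.C (star α + α)
      + PowerSeries.X * PowerSeries.X * PowerSeries.C (star α * α) := by
    simp only [blaschkeDenom, star_star, map_add, map_mul, mul_sub, sub_mul, mul_one, one_mul,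
      mul_add, mul_assoc, hX']
    abel
  have hM : (PowerSeries.X - PowerSeries.C (star α)) * (PowerSeries.X - PowerSeries.C α)
      = PowerSeries.X * PowerSeries.X - PowerSeries.X * PowerSeries.C (star α + α)
        + PowerSeries.C (star α * α) := by
    simp only [map_add, map_mul, mul_sub, sub_mul, mul_add, hX]
    abel
  have cD : Commute (PowerSeries.C a) (blaschkeDenom α * blaschkeDenom (star α)) := by
    rw [hD]
    exact ((Commute.one_right _).sub_right
      (cX.mul_right (commute_C (commute_star_add_self a α)))).add_right
      ((cX.mul_right cX).mul_right (commute_C (commute_star_mul_self a α)))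
  have cM : Commute (PowerSeries.C a)
      ((PowerSeries.X - PowerSeries.C (star α)) * (PowerSeries.X - PowerSeries.C α)) := by
    rw [hM]
    exact ((cX.mul_right cX).sub_right
      (cX.mul_right (commute_C (commute_star_add_self a α)))).add_right
      (commute_C (commute_star_mul_self a α))
  have hDN : blaschkeDenom α * blaschkeDenom (star α) *
      (blaschkeFactor (star α) * blaschkeFactor α)
      = (PowerSeries.X - PowerSeries.C (star α)) * (PowerSeries.X - PowerSeries.C α) := by
    rw [mul_assoc, ← mul_assoc (blaschkeDenom (star α)), blaschkeDenom_mul_blaschkeFactor,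
      ← mul_assoc, ← (commute_X_sub_C_blaschkeDenom (Commute.refl (star α))).eq, mul_assoc,
      blaschkeDenom_mul_blaschkeFactor]
  have hu : IsUnit (blaschkeDenom α * blaschkeDenom (star α)) :=
    (isUnit_blaschkeDenom α).mul (isUnit_blaschkeDenom (star α))
  refine hu.mul_left_cancel ?_
  rw [← mul_assoc, ← cD.eq, mul_assoc, hDN, cM.eq, ← hDN, mul_assoc]

theorem commute_leftEval_of_commute_C {p : PowerSeries ℍ[ℝ]}
    (h : ∀ a, Commute (PowerSeries.C a) p) (γ : ℍ[ℝ]) : Commute γ (leftEval p γ) := by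
  refine Commute.tsum_right _ fun k => ((Commute.refl γ).pow_right k).mul_right ?_
  have := congrArg (PowerSeries.coeff k) (h γ).eq
  rwa [PowerSeries.coeff_C_mul, PowerSeries.coeff_mul_C] at this

/-- Division by the linear factor at a zero. -/
theorem exists_eq_X_sub_C_mul {f : PowerSeries ℍ[ℝ]} (hf : DiscSummable f) {α : ℍ[ℝ]}
    (hα : ‖α‖ < 1) (h0 : leftEval f α = 0) :
    ∃ h, DiscSummable h ∧ f = (PowerSeries.X - PowerSeries.C α) * h := by
  have hsum : ∀ k, Summable fun j : ℕ => α ^ j * PowerSeries.coeff (k + j) f := by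
    intro k
    obtain ⟨t, ht, ht1⟩ := exists_between hα
    have ht0 : 0 < t := (norm_nonneg _).trans_lt ht
    have h1 := ((summable_nat_add_iff k).2 (hf t ht0.le ht1)).mul_left (t ^ k)⁻¹
    refine Summable.of_norm_bounded h1 fun j => ?_
    rw [norm_mul, norm_pow, pow_add, add_comm k j]
    have : (t ^ k)⁻¹ * (t ^ j * t ^ k * ‖PowerSeries.coeff (j + k) f‖)
        = t ^ j * ‖PowerSeries.coeff (j + k) f‖ := by
      field_simp
    rw [this]
    gcongr
  -- Synthetic division: these tails satisfy `c k = f_k + α c (k + 1)`, and `c 0 = f(α) = 0`, so the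
  -- shifted sequence gives the quotient.
  set c : ℕ → ℍ[ℝ] := fun k => ∑' j : ℕ, α ^ j * PowerSeries.coeff (k + j) f with hc
  have hrec : ∀ k, c k = PowerSeries.coeff k f + α * c (k + 1) := by
    intro k
    rw [hc]
    simp only
    rw [(hsum k).tsum_eq_zero_add, ← (hsum (k + 1)).tsum_mul_left]
    simp only [pow_zero, one_mul, add_zero]
    congr 1
    refine tsum_congr fun j => ?_
    rw [pow_succ', mul_assoc, show k + (j + 1) = k + 1 + j by ring]
  have hc0 : c 0 = 0 := by
    rw [← h0, hc, leftEval]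
    simp
  refine ⟨PowerSeries.mk fun k => c (k + 1), ?_, ?_⟩
  · intro r hr0 hr1
    -- `t > |α|` bounds the tails by `M t⁻ⁿ`; `t > r` makes the resulting series at radius `r`
    -- geometric.
    obtain ⟨t, ht, ht1⟩ := exists_between (max_lt hα hr1)
    have htα : ‖α‖ < t := (le_max_left _ _).trans_lt ht
    have htr : r < t := (le_max_right _ _).trans_lt ht
    have ht0 : 0 < t := (norm_nonneg _).trans_lt htα
    set M := ∑' n, t ^ n * ‖PowerSeries.coeff n f‖ with hM
    have hbound : ∀ n, ‖c n‖ ≤ M * (t ^ n)⁻¹ := by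
      intro n
      have h1 := (summable_nat_add_iff n).2 (hf t ht0.le ht1)
      have h2 : ‖c n‖ ≤ ∑' j, t ^ (j + n) * ‖PowerSeries.coeff (j + n) f‖ * (t ^ n)⁻¹ := by
        refine tsum_of_norm_bounded (h1.mul_right _).hasSum fun j => ?_
        rw [norm_mul, norm_pow, pow_add, add_comm n j]
        have : t ^ j * t ^ n * ‖PowerSeries.coeff (j + n) f‖ * (t ^ n)⁻¹
            = t ^ j * ‖PowerSeries.coeff (j + n) f‖ := by
          field_simp
        rw [this]
        gcongr
      refine h2.trans ?_
      rw [h1.tsum_mul_right]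
      gcongr
      have h3 := (hf t ht0.le ht1).sum_add_tsum_nat_add n
      have h4 : 0 ≤ ∑ i ∈ Finset.range n, t ^ i * ‖PowerSeries.coeff i f‖ := by positivity
      linarith
    refine Summable.of_nonneg_of_le (fun k => by positivity) (fun k => ?_)
      ((summable_geometric_of_lt_one (r := r / t) (by positivity)
        ((div_lt_one ht0).2 htr)).mul_left (M * t⁻¹))
    rw [PowerSeries.coeff_mk]
    calc r ^ k * ‖c (k + 1)‖ ≤ r ^ k * (M * (t ^ (k + 1))⁻¹) := by gcongr; exact hbound _
      _ = M * t⁻¹ * (r / t) ^ k := by rw [div_pow, pow_succ]; field_simp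
  · ext1 n
    rw [sub_mul, map_sub, PowerSeries.coeff_C_mul, PowerSeries.coeff_mk]
    cases n with
    | zero =>
      have := hrec 0
      rw [hc0] at this
      simp only [PowerSeries.coeff_zero_X_mul, zero_sub]
      exact eq_neg_of_add_eq_zero_left this.symm
    | succ n =>
      rw [PowerSeries.coeff_succ_X_mul, PowerSeries.coeff_mk, hrec (n + 1)]
      abel

/-- Centrality of `𝐛_ᾱ 𝐛_α` gives the untwisted identity `(𝐛_ᾱ f)(γ) = (𝐛_ᾱ 𝐛_α)(γ) h(γ)`. The last
clause keeps an annulus outside `|α|` zero-free under division. -/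
theorem IsLeftInner.exists_eq_blaschkeFactor_mul {f : PowerSeries ℍ[ℝ]} (hf : IsLeftInner f)
    {α : ℍ[ℝ]} (hα : ‖α‖ < 1) (h0 : leftEval f α = 0) :
    ∃ h, IsLeftInner h ∧ f = blaschkeFactor α * h ∧
      ∀ β : ℍ[ℝ], ‖β‖ < 1 → ‖α‖ < ‖β‖ → leftEval h β = 0 →
        ∃ γ : ℍ[ℝ], ‖γ‖ = ‖β‖ ∧ leftEval f γ = 0 := by
  obtain ⟨h₁, hh₁, hfh⟩ := exists_eq_X_sub_C_mul hf.1 hα h0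
  have hα' : ‖star α‖ < 1 := by simpa using hα
  set h := blaschkeDenom α * h₁ with hh
  have hS : DiscSummable h := (discSummable_blaschkeDenom α).mul hh₁
  have hfb : f = blaschkeFactor α * h := by
    rw [hfh, hh, blaschkeFactor, ← mul_assoc, mul_assoc (_ - _), geometric_mul_blaschkeDenom,
      mul_one]
  have hNi := (isLeftInner_blaschkeFactor hα').mul (isLeftInner_blaschkeFactor hα)
  have hN : ∀ γ, ‖γ‖ < 1 →
      leftEval (blaschkeFactor (star α) * f) γ
        = leftEval (blaschkeFactor (star α) * blaschkeFactor α) γ * leftEval h γ := by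
    intro γ hγ
    rw [hfb, ← mul_assoc, leftEval_mul hNi.1 hS hγ, twist_of_commute
      (commute_leftEval_of_commute_C (fun a => commute_C_blaschkeFactor_mul a α) γ)]
  refine ⟨h, ⟨hS, ?_⟩, hfb, fun β hβ hαβ hz => ?_⟩
  · have hbf := ((isLeftInner_blaschkeFactor hα').mul hf).2
    have hdiv := hbf.div hNi.2 one_ne_zero
    rw [div_one] at hdiv
    refine hdiv.congr' ?_
    filter_upwards [eventually_norm_lt_one, hNi.2.eventually_ne one_ne_zero] with γ hγ hne
    rw [Pi.div_apply, hN γ hγ, norm_mul, mul_div_cancel_left₀ _ hne]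
  · have h1 := hN β hβ
    rw [hz, mul_zero, leftEval_mul (isLeftInner_blaschkeFactor hα').1 hf.1 hβ] at h1
    refine ⟨_, norm_twist (blaschkeFactor (star α)) β, (mul_eq_zero.1 h1).resolve_left ?_⟩
    exact leftEval_blaschkeFactor_ne_zero hα' hβ (by simpa using hαβ.ne)

/-! ### Complexification and slices -/

/-- The coordinates of a quaternion as a vector of `ℂ⁴`. -/
def complexify : ℍ[ℝ] →ₗᵢ[ℝ] EuclideanSpace ℂ (Fin 4) where
  toFun a := !₂[(a.re : ℂ), (a.imI : ℂ), (a.imJ : ℂ), (a.imK : ℂ)]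
  map_add' a b := by ext i; fin_cases i <;> simp
  map_smul' r a := by ext i; fin_cases i <;> simp
  norm_map' a := by
    rw [← sq_eq_sq₀ (norm_nonneg _) (norm_nonneg _), EuclideanSpace.norm_sq_eq, sq ‖a‖,
      ← Quaternion.normSq_eq_norm_mul_self, Quaternion.normSq_def']
    simp [Fin.sum_univ_four]

theorem norm_sq_complexify_add (A B : ℍ[ℝ]) :
    ‖complexify A + Complex.I • complexify B‖ ^ 2 = ‖A‖ ^ 2 + ‖B‖ ^ 2 := by
  rw [EuclideanSpace.norm_sq_eq, sq ‖A‖, sq ‖B‖]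
  simp only [← Quaternion.normSq_eq_norm_mul_self, Quaternion.normSq_def', complexify,
    Complex.sq_norm, Complex.normSq_apply]
  simp [Fin.sum_univ_four]
  ring

theorem sum_sq_complexify_add (A B : ℍ[ℝ]) :
    ∑ j, (complexify A + Complex.I • complexify B) j ^ 2
      = ((‖A‖ ^ 2 - ‖B‖ ^ 2 : ℝ) : ℂ) + ((2 * (B * star A).re : ℝ) : ℂ) * Complex.I := by
  rw [sq ‖A‖, sq ‖B‖]
  simp only [← Quaternion.normSq_eq_norm_mul_self, Quaternion.normSq_def', complexify]
  simp [Fin.sum_univ_four]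
  linear_combination
    ((B.re : ℂ) ^ 2 + (B.imI : ℂ) ^ 2 + (B.imJ : ℂ) ^ 2 + (B.imK : ℂ) ^ 2) * Complex.I_sq

theorem norm_sq_add_mul (A B I : ℍ[ℝ]) (hI : ‖I‖ = 1) :
    ‖A + I * B‖ ^ 2 = ‖A‖ ^ 2 + ‖B‖ ^ 2 + 2 * (I * (B * star A)).re := by
  have h : ‖A + I * B‖ ^ 2 = ‖A‖ ^ 2 + ‖I * B‖ ^ 2 + 2 * ((I * B) * star A).re := by
    simp only [sq, ← Quaternion.normSq_eq_norm_mul_self, Quaternion.normSq_add]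
    simp
    ring
  rw [h, norm_mul, hI, one_mul, mul_assoc]

/-- Take `I` along the imaginary part of `w`, so that `Re (I w) = -|Im w|`; any imaginary unit works
if `w` is real. -/
theorem exists_imaginary_unit (w : ℍ[ℝ]) :
    ∃ I : ℍ[ℝ], I.re = 0 ∧ ‖I‖ = 1 ∧ (I * w).re ^ 2 = ‖w‖ ^ 2 - w.re ^ 2 := by
  have hw : ‖w‖ ^ 2 = w.re ^ 2 + w.imI ^ 2 + w.imJ ^ 2 + w.imK ^ 2 := by
    rw [sq, ← Quaternion.normSq_eq_norm_mul_self, Quaternion.normSq_def']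
  set s : ℝ := w.imI ^ 2 + w.imJ ^ 2 + w.imK ^ 2 with hs
  have hs0 : 0 ≤ s := by positivity
  have hmk : ∀ x y z : ℝ, x ^ 2 + y ^ 2 + z ^ 2 = 1 →
      ∃ I : ℍ[ℝ], I.re = 0 ∧ I.imI = x ∧ I.imJ = y ∧ I.imK = z ∧ ‖I‖ = 1 := by
    intro x y z h
    set I : ℍ[ℝ] := ⟨0, x, y, z⟩ with hI
    refine ⟨I, rfl, rfl, rfl, rfl, ?_⟩
    rw [← sq_eq_sq₀ (norm_nonneg _) zero_le_one, sq, ← Quaternion.normSq_eq_norm_mul_self,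
      Quaternion.normSq_def']
    simpa [hI] using h
  rcases hs0.eq_or_lt with h | h
  · obtain ⟨I, h0, h1, h2, h3, hn⟩ := hmk 1 0 0 (by norm_num)
    refine ⟨I, h0, hn, ?_⟩
    have hwI : w.imI = 0 := by nlinarith [sq_nonneg w.imI, sq_nonneg w.imJ, sq_nonneg w.imK]
    rw [hw, Quaternion.re_mul, h0, h1, h2, h3, hwI]
    nlinarith
  · have hq : √s ^ 2 = s := Real.sq_sqrt hs0
    have hq0 : √s ≠ 0 := (Real.sqrt_pos.2 h).ne'
    obtain ⟨I, h0, h1, h2, h3, hn⟩ := hmk (w.imI / √s) (w.imJ / √s) (w.imK / √s) (by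
      simp only [div_pow, hq, ← add_div]
      exact div_self h.ne')
    refine ⟨I, h0, hn, ?_⟩
    have e : (I * w).re = -(s / √s) := by
      rw [Quaternion.re_mul, h0, h1, h2, h3, hs]
      ring
    rw [e, hw, neg_sq, div_pow, hq, sq s, mul_div_assoc, div_self h.ne']
    linarith

/-- With `w = B Ā`, the squares of the two sides are `(|A|² - |B|²)² + 4 (Re w)²` and `(|A|² +
|B|²)² - 4 (Re (I w))²`, equal for the `I` adapted to `w`. -/
theorem exists_norm_sum_sq_eq (A B : ℍ[ℝ]) :
    ∃ I : ℍ[ℝ], I.re = 0 ∧ ‖I‖ = 1 ∧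
      ‖∑ j, (complexify A + Complex.I • complexify B) j ^ 2‖ = ‖A + I * B‖ * ‖A + -I * B‖ := by
  obtain ⟨I, h0, h1, h2⟩ := exists_imaginary_unit (B * star A)
  refine ⟨I, h0, h1, ?_⟩
  rw [← sq_eq_sq₀ (norm_nonneg _) (by positivity), mul_pow, norm_sq_add_mul A B I h1,
    norm_sq_add_mul A B (-I) (by rwa [norm_neg]), sum_sq_complexify_add, Complex.sq_norm,
    Complex.normSq_add_mul_I, neg_mul, Quaternion.re_neg]
  rw [norm_mul, norm_star] at h2
  linear_combination 4 * h2

/-- The copy `x + I y` of the complex number `x + i y` on the slice spanned by `I`. -/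
def slice (I : ℍ[ℝ]) (z : ℂ) : ℍ[ℝ] := (z.re : ℍ[ℝ]) + z.im • I

theorem norm_slice {I : ℍ[ℝ]} (h0 : I.re = 0) (h1 : ‖I‖ = 1) (z : ℂ) : ‖slice I z‖ = ‖z‖ := by
  have h : I.imI ^ 2 + I.imJ ^ 2 + I.imK ^ 2 = 1 := by
    have := Quaternion.normSq_eq_norm_mul_self I
    rw [h1, Quaternion.normSq_def', h0] at this
    linarith
  rw [← sq_eq_sq₀ (norm_nonneg _) (norm_nonneg _), sq ‖slice I z‖,
    ← Quaternion.normSq_eq_norm_mul_self, Quaternion.normSq_def', Complex.sq_norm,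
    Complex.normSq_apply]
  simp [slice, h0]
  linear_combination z.im ^ 2 * h

theorem slice_pow {I : ℍ[ℝ]} (h0 : I.re = 0) (h1 : ‖I‖ = 1) (z : ℂ) (k : ℕ) :
    slice I z ^ k = slice I (z ^ k) := by
  have hI : I * I = -1 := by
    rw [← sq, Quaternion.sq_eq_neg_normSq.2 h0, Quaternion.normSq_eq_norm_mul_self, h1]
    simp
  have h : ∀ z, slice I z = Complex.liftAux I hI z := fun z => by
    rw [Complex.liftAux_apply]; rfl
  rw [h, h, map_pow]

/-- The holomorphic `ℂ⁴`-valued function with the coefficients of `f`. -/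
def complexEval (f : PowerSeries ℍ[ℝ]) (z : ℂ) : EuclideanSpace ℂ (Fin 4) :=
  ∑' k : ℕ, z ^ k • complexify (PowerSeries.coeff k f)

theorem DiscSummable.summable_complexEval {f : PowerSeries ℍ[ℝ]} (hf : DiscSummable f) {z : ℂ}
    (hz : ‖z‖ < 1) : Summable fun k : ℕ => z ^ k • complexify (PowerSeries.coeff k f) :=
  Summable.of_norm (by
    simpa [norm_smul, norm_pow, complexify.norm_map] using hf ‖z‖ (norm_nonneg _) hz)

theorem DiscSummable.differentiableOn_complexEval {f : PowerSeries ℍ[ℝ]} (hf : DiscSummable f) :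
    DifferentiableOn ℂ (complexEval f) (Metric.ball 0 1) := by
  intro z hz
  rw [mem_ball_zero_iff] at hz
  obtain ⟨t, ht, ht1⟩ := exists_between hz
  have ht0 : 0 ≤ t := (norm_nonneg _).trans ht.le
  have h : DifferentiableOn ℂ (complexEval f) (Metric.ball 0 t) := by
    refine Complex.differentiableOn_tsum_of_summable_norm (hf t ht0 ht1) (fun k => ?_)
      Metric.isOpen_ball fun k w hw => ?_
    · exact ((differentiable_id.pow k).smul_const _).differentiableOn
    · rw [norm_smul, norm_pow, complexify.norm_map]
      rw [mem_ball_zero_iff] at hw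
      gcongr
  exact (h.differentiableAt (Metric.isOpen_ball.mem_nhds (by simpa using ht))).differentiableWithinAt

/-- Splitting `zᵏ` into real and imaginary parts gives fixed `A`, `B` with `F(z) = A + iB` and `f(x
+ Iy) = A + I B` for every imaginary unit `I`; the two points are `x ± Iy`. -/
theorem DiscSummable.exists_conjugates {f : PowerSeries ℍ[ℝ]} (hf : DiscSummable f) {z : ℂ}
    (hz : ‖z‖ < 1) :
    ∃ γ₁ γ₂ : ℍ[ℝ], ‖γ₁‖ = ‖z‖ ∧ ‖γ₂‖ = ‖z‖ ∧
      2 * ‖complexEval f z‖ ^ 2 = ‖leftEval f γ₁‖ ^ 2 + ‖leftEval f γ₂‖ ^ 2 ∧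
      ‖∑ j, complexEval f z j ^ 2‖ = ‖leftEval f γ₁‖ * ‖leftEval f γ₂‖ := by
  have hsum := hf ‖z‖ (norm_nonneg _) hz
  have hA : Summable fun k : ℕ => (z ^ k).re • PowerSeries.coeff k f := by
    refine Summable.of_norm_bounded hsum fun k => ?_
    rw [norm_smul, ← norm_pow]
    gcongr
    exact Complex.abs_re_le_norm _
  have hB : Summable fun k : ℕ => (z ^ k).im • PowerSeries.coeff k f := by
    refine Summable.of_norm_bounded hsum fun k => ?_
    rw [norm_smul, ← norm_pow]
    gcongr
    exact Complex.abs_im_le_norm _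
  set A := ∑' k : ℕ, (z ^ k).re • PowerSeries.coeff k f
  set B := ∑' k : ℕ, (z ^ k).im • PowerSeries.coeff k f
  have hslice : ∀ I : ℍ[ℝ], I.re = 0 → ‖I‖ = 1 → leftEval f (slice I z) = A + I * B := by
    intro I h0 h1
    refine HasSum.tsum_eq ?_
    refine (hA.hasSum.add (hB.hasSum.mul_left I)).congr_fun fun k => ?_
    rw [slice_pow h0 h1, slice, add_mul, Quaternion.coe_mul_eq_smul, smul_mul_assoc,
      mul_smul_comm]
  have hF : complexEval f z = complexify A + Complex.I • complexify B := by
    refine HasSum.tsum_eq ?_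
    have h1 := hA.hasSum.mapL complexify.toContinuousLinearMap
    have h2 := (hB.hasSum.mapL complexify.toContinuousLinearMap).const_smul Complex.I
    refine (h1.add h2).congr_fun fun k => ?_
    simp only [LinearIsometry.coe_toContinuousLinearMap, map_smul]
    rw [← Complex.coe_smul, ← Complex.coe_smul (z ^ k).im, smul_smul, ← add_smul, mul_comm,
      Complex.re_add_im]
  obtain ⟨I, h0, h1, h2⟩ := exists_norm_sum_sq_eq A B
  have h1' : ‖-I‖ = 1 := by rwa [norm_neg]
  have h0' : (-I).re = 0 := by simp [h0]
  refine ⟨slice I z, slice (-I) z, norm_slice h0 h1 z, norm_slice h0' h1' z, ?_, ?_⟩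
  · rw [hslice I h0 h1, hslice _ h0' h1', hF, norm_sq_complexify_add, norm_sq_add_mul A B I h1,
      norm_sq_add_mul A B (-I) h1', neg_mul, Quaternion.re_neg]
    ring
  · rw [hslice I h0 h1, hslice _ h0' h1', hF, h2]

theorem leftEval_zero (f : PowerSeries ℍ[ℝ]) : leftEval f 0 = PowerSeries.coeff 0 f := by
  rw [leftEval, tsum_eq_single 0 (fun k hk => by simp [hk])]
  simp

theorem complexEval_zero (f : PowerSeries ℍ[ℝ]) :
    complexEval f 0 = complexify (PowerSeries.coeff 0 f) := by
  rw [complexEval, tsum_eq_single 0 (fun k hk => by simp [hk])]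
  simp

/-! ### Extremal principles -/

/-- Minimum modulus principle. -/
theorem IsLeftInner.one_le_norm_coeff_zero {f : PowerSeries ℍ[ℝ]} (hf : IsLeftInner f)
    (hne : ∀ γ : ℍ[ℝ], ‖γ‖ < 1 → leftEval f γ ≠ 0) : 1 ≤ ‖PowerSeries.coeff 0 f‖ := by
  by_contra! hlt
  obtain ⟨c, hc, hc1⟩ := exists_between hlt
  have hc0 : 0 < c := (norm_nonneg _).trans_lt hc
  obtain ⟨r, hr0, hr1, hr⟩ := eventually_normToOneLeft_iff.1 (hf.2.eventually_const_lt hc1)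
  set G : ℂ → ℂ := fun z => ∑ j, complexEval f z j ^ 2 with hG
  have hGd : DifferentiableOn ℂ G (Metric.ball 0 1) := by
    refine DifferentiableOn.fun_sum fun j _ => DifferentiableOn.pow ?_ 2
    exact (EuclideanSpace.proj (𝕜 := ℂ) j).differentiable.comp_differentiableOn
      hf.1.differentiableOn_complexEval
  have hG0 : ∀ z ∈ Metric.ball (0 : ℂ) 1, G z ≠ 0 := by
    intro z hz
    rw [mem_ball_zero_iff] at hz
    obtain ⟨γ₁, γ₂, h1, h2, -, h3⟩ := hf.1.exists_conjugates hz
    rw [← norm_ne_zero_iff, hG, h3]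
    exact mul_ne_zero (norm_ne_zero_iff.2 (hne _ (h1 ▸ hz))) (norm_ne_zero_iff.2 (hne _ (h2 ▸ hz)))
  have hinv : DiffContOnCl ℂ (fun z => (G z)⁻¹) (Metric.ball 0 r) := by
    refine DifferentiableOn.diffContOnCl ((hGd.inv hG0).mono ?_)
    rw [closure_ball _ hr0.ne']
    exact Metric.closedBall_subset_ball hr1
  -- Maximum modulus for `1/G`: on the sphere `|G| ≥ c²`, while at the centre both points are `0`
  -- and `|G 0| = |f_0|² < c²`.
  have hmax := Complex.norm_le_of_forall_mem_frontier_norm_le (C := (c * c)⁻¹)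
    Metric.isBounded_ball hinv (z := 0) (fun z hz => ?_)
    (subset_closure (Metric.mem_ball_self hr0))
  · obtain ⟨γ₁, γ₂, h1, h2, -, h3⟩ := hf.1.exists_conjugates (z := 0) (by simp)
    rw [norm_zero, norm_eq_zero] at h1 h2
    rw [h1, h2, leftEval_zero] at h3
    have hpos : 0 < ‖G 0‖ := norm_pos_iff.2 (hG0 0 (by simp))
    rw [norm_inv, inv_le_inv₀ hpos (by positivity), hG, h3] at hmax
    nlinarith [norm_nonneg (PowerSeries.coeff 0 f)]
  · rw [frontier_ball _ hr0.ne', mem_sphere_zero_iff_norm] at hz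
    obtain ⟨γ₁, γ₂, h1, h2, -, h3⟩ := hf.1.exists_conjugates (z := z) (hz ▸ hr1)
    have a1 := hr γ₁ (by rw [h1, hz]) (by rw [h1, hz]; exact hr1)
    have a2 := hr γ₂ (by rw [h2, hz]) (by rw [h2, hz]; exact hr1)
    rw [norm_inv, hG, h3]
    gcongr

theorem IsLeftInner.norm_complexEval_le_one {f : PowerSeries ℍ[ℝ]} (hf : IsLeftInner f) {z : ℂ}
    (hz : ‖z‖ < 1) : ‖complexEval f z‖ ≤ 1 := by
  refine le_of_forall_gt_imp_ge_of_dense fun c hc => ?_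
  obtain ⟨r, hr0, hr1, hr⟩ := eventually_normToOneLeft_iff.1 (hf.2.eventually_lt_const hc)
  -- This sphere lies where `|f| < c`, and its closed ball contains `z`.
  set s := max r ‖z‖ with hs
  have hs1 : s < 1 := max_lt hr1 hz
  have hs0 : 0 < s := hr0.trans_le (le_max_left _ _)
  have hd : DiffContOnCl ℂ (complexEval f) (Metric.ball 0 s) := by
    refine DifferentiableOn.diffContOnCl (hf.1.differentiableOn_complexEval.mono ?_)
    rw [closure_ball _ hs0.ne']
    exact Metric.closedBall_subset_ball hs1
  refine Complex.norm_le_of_forall_mem_frontier_norm_le Metric.isBounded_ball hd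
    (fun w hw => ?_) (by rw [closure_ball _ hs0.ne']; simp [hs])
  rw [frontier_ball _ hs0.ne', mem_sphere_zero_iff_norm] at hw
  obtain ⟨γ₁, γ₂, h1, h2, h3, -⟩ := hf.1.exists_conjugates (z := w) (hw ▸ hs1)
  have a1 := hr γ₁ (by rw [h1, hw]; exact le_max_left _ _) (by rw [h1, hw]; exact hs1)
  have a2 := hr γ₂ (by rw [h2, hw]; exact le_max_left _ _) (by rw [h2, hw]; exact hs1)
  refine (sq_le_sq₀ (norm_nonneg _) (by linarith)).1 ?_
  nlinarith [norm_nonneg (leftEval f γ₁), norm_nonneg (leftEval f γ₂)]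

/-- `|F| ≤ 1 ≤ |F(0)|` puts an interior maximum at the origin; the Euclidean norm is strictly
convex, so `F` itself is constant and its higher Taylor coefficients vanish. -/
theorem IsLeftInner.eq_C {f : PowerSeries ℍ[ℝ]} (hf : IsLeftInner f)
    (h : 1 ≤ ‖PowerSeries.coeff 0 f‖) :
    ‖PowerSeries.coeff 0 f‖ = 1 ∧ f = PowerSeries.C (PowerSeries.coeff 0 f) := by
  have hle := hf.norm_complexEval_le_one (z := 0) (by simp)
  rw [complexEval_zero, complexify.norm_map] at hle
  have hconst : Set.EqOn (complexEval f) (Function.const ℂ (complexEval f 0))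
      (Metric.ball 0 1) := by
    refine Complex.eqOn_of_isPreconnected_of_isMaxOn_norm
      (convex_ball (0 : ℂ) 1).isPreconnected Metric.isOpen_ball
      hf.1.differentiableOn_complexEval (by simp) fun z hz => ?_
    rw [mem_ball_zero_iff] at hz
    simp only [Set.mem_ofPred_eq, Function.comp, complexEval_zero, complexify.norm_map]
    exact (hf.norm_complexEval_le_one hz).trans h
  set p : FormalMultilinearSeries ℂ ℂ (EuclideanSpace ℂ (Fin 4)) := fun n =>
    ContinuousMultilinearMap.mkPiRing ℂ (Fin n) (complexify (PowerSeries.coeff n f)) with hp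
  have hpc : ∀ n, p.coeff n = complexify (PowerSeries.coeff n f) := by
    intro n
    simp [FormalMultilinearSeries.coeff, hp]
  have hball : Metric.ball (0 : ℂ) 1 ∈ 𝓝 0 := Metric.ball_mem_nhds _ one_pos
  have hps : HasFPowerSeriesAt (complexEval f) p 0 := by
    rw [hasFPowerSeriesAt_iff]
    filter_upwards [hball] with z hz
    rw [mem_ball_zero_iff] at hz
    simp only [hpc, zero_add]
    exact (hf.1.summable_complexEval hz).hasSum
  have heq := hps.eq_formalMultilinearSeries_of_eventually
    (hasFPowerSeriesAt_const (c := complexEval f 0)) (by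
      filter_upwards [hball] with z hz using hconst hz)
  refine ⟨le_antisymm hle h, ?_⟩
  ext1 n
  rcases eq_or_ne n 0 with rfl | hn
  · simp
  · rw [PowerSeries.coeff_C, if_neg hn]
    have := hpc n
    rw [heq, FormalMultilinearSeries.coeff, constFormalMultilinearSeries_apply_of_nonzero hn]
      at this
    exact (map_eq_zero_iff complexify complexify.injective).1 this.symm

/-! ### Termination of the factorization -/

theorem blaschkeFactor_zero : blaschkeFactor 0 = PowerSeries.X := by
  have h : (PowerSeries.mk fun k => star (0 : ℍ[ℝ]) ^ k) = 1 := by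
    ext1 n
    simp [PowerSeries.coeff_one, zero_pow_eq]
  rw [blaschkeFactor, h]
  simp

theorem norm_coeff_zero_blaschkeFactor_mul (α : ℍ[ℝ]) (h : PowerSeries ℍ[ℝ]) :
    ‖PowerSeries.coeff 0 (blaschkeFactor α * h)‖ = ‖α‖ * ‖PowerSeries.coeff 0 h‖ := by
  simp [blaschkeFactor, PowerSeries.coeff_mul, Finset.HasAntidiagonal.antidiagonal]

theorem IsFiniteBlaschkeProduct.blaschkeFactor_mul {h : PowerSeries ℍ[ℝ]}
    (hh : IsFiniteBlaschkeProduct h) {α : ℍ[ℝ]} (hα : ‖α‖ < 1) :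
    IsFiniteBlaschkeProduct (blaschkeFactor α * h) := by
  obtain ⟨l, φ, hl, hφ, rfl⟩ := hh
  refine ⟨α :: l, φ, ?_, hφ, ?_⟩
  · simpa [hα] using hl
  · rw [List.map_cons, List.prod_cons, mul_assoc]

theorem IsLeftInner.isFiniteBlaschkeProduct_of_one_le {f : PowerSeries ℍ[ℝ]} (hf : IsLeftInner f)
    (h : 1 ≤ ‖PowerSeries.coeff 0 f‖) : IsFiniteBlaschkeProduct f := by
  obtain ⟨h1, h2⟩ := hf.eq_C h
  exact ⟨[], PowerSeries.coeff 0 f, by simp, h1, by simpa using h2⟩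

/-- The exponent bounds the number of zeros left to remove: `|f_0| = |α| |h_0|` with `|α| < r` turns
`r ^ (n + 1) < |f_0|` into `r ^ n < |h_0|`. -/
theorem IsLeftInner.isFiniteBlaschkeProduct_of_pow_lt {r : ℝ} (hr0 : 0 < r) (n : ℕ) :
    ∀ {f : PowerSeries ℍ[ℝ]}, IsLeftInner f →
      (∀ γ : ℍ[ℝ], r ≤ ‖γ‖ → ‖γ‖ < 1 → leftEval f γ ≠ 0) →
      r ^ n < ‖PowerSeries.coeff 0 f‖ → IsFiniteBlaschkeProduct f := by
  induction n with
  | zero =>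
    intro f hf _ hlt
    exact hf.isFiniteBlaschkeProduct_of_one_le (by simpa using hlt.le)
  | succ n ih =>
    intro f hf hz hlt
    by_cases hne : ∀ γ : ℍ[ℝ], ‖γ‖ < 1 → leftEval f γ ≠ 0
    · exact hf.isFiniteBlaschkeProduct_of_one_le (hf.one_le_norm_coeff_zero hne)
    push Not at hne
    obtain ⟨α, hα, h0⟩ := hne
    have hαr : ‖α‖ < r := lt_of_not_ge fun h => hz α h hα h0
    obtain ⟨h, hh, rfl, hzh⟩ := hf.exists_eq_blaschkeFactor_mul hα h0
    refine (ih hh (fun β h1 h2 h3 => ?_) ?_).blaschkeFactor_mul hα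
    · obtain ⟨γ, h4, h5⟩ := hzh β h2 (hαr.trans_le h1) h3
      exact hz γ (h4 ▸ h1) (h4 ▸ h2) h5
    · rw [norm_coeff_zero_blaschkeFactor_mul, pow_succ'] at hlt
      have h1 := hlt.trans_le (mul_le_mul_of_nonneg_right hαr.le (norm_nonneg _))
      exact lt_of_mul_lt_mul_left h1 hr0.le

/-- While `f_0 = 0`, the factor `𝐛_0 = z` splits off and lowers `m` by one. -/
theorem IsLeftInner.isFiniteBlaschkeProduct_of_coeff_ne_zero (m : ℕ) :
    ∀ {f : PowerSeries ℍ[ℝ]}, IsLeftInner f → PowerSeries.coeff m f ≠ 0 →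
      IsFiniteBlaschkeProduct f := by
  have main : ∀ {f : PowerSeries ℍ[ℝ]}, IsLeftInner f → PowerSeries.coeff 0 f ≠ 0 →
      IsFiniteBlaschkeProduct f := by
    intro f hf h0
    obtain ⟨r, hr0, hr1, hr⟩ := eventually_normToOneLeft_iff.1 (hf.2.eventually_ne one_ne_zero)
    obtain ⟨n, hn⟩ := exists_pow_lt_of_lt_one (norm_pos_iff.2 h0) hr1
    exact isFiniteBlaschkeProduct_of_pow_lt hr0 n hf
      (fun γ h1 h2 => norm_ne_zero_iff.1 (hr γ h1 h2)) hn
  induction m with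
  | zero => exact main
  | succ m ih =>
    intro f hf hm
    by_cases h0 : PowerSeries.coeff 0 f = 0
    · obtain ⟨h, hh, rfl, -⟩ := hf.exists_eq_blaschkeFactor_mul (α := 0) (by simp)
        (by rw [leftEval_zero, h0])
      refine (ih hh ?_).blaschkeFactor_mul (by simp)
      rwa [blaschkeFactor_zero, PowerSeries.coeff_succ_X_mul] at hm
    · exact main hf h0

theorem IsLeftInner.isFiniteBlaschkeProduct {f : PowerSeries ℍ[ℝ]} (hf : IsLeftInner f) :
    IsFiniteBlaschkeProduct f := by
  obtain ⟨m, hm⟩ : ∃ m, PowerSeries.coeff m f ≠ 0 := by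
    by_contra! h
    obtain ⟨r, hr0, hr1, hr⟩ := eventually_normToOneLeft_iff.1 (hf.2.eventually_ne one_ne_zero)
    have hn : ‖(r : ℍ[ℝ])‖ = r := by rw [Quaternion.norm_coe, Real.norm_of_nonneg hr0.le]
    refine hr r hn.ge (hn.trans_lt hr1) ?_
    simp [leftEval, h]
  exact isFiniteBlaschkeProduct_of_coeff_ne_zero m hf hm

/-! ### Conjugation and right evaluation -/

/-- The power series with conjugate coefficients. -/
def conjSeries (f : PowerSeries ℍ[ℝ]) : PowerSeries ℍ[ℝ] :=
  PowerSeries.mk fun k => star (PowerSeries.coeff k f)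

theorem conjSeries_conjSeries (f : PowerSeries ℍ[ℝ]) : conjSeries (conjSeries f) = f := by
  ext1 n
  simp [conjSeries]

theorem conjSeries_mul (f g : PowerSeries ℍ[ℝ]) :
    conjSeries (f * g) = conjSeries g * conjSeries f := by
  ext1 n
  simp only [conjSeries, PowerSeries.coeff_mk, PowerSeries.coeff_mul, star_sum, star_mul]
  rw [← Finset.Nat.sum_antidiagonal_swap]
  simp

theorem conjSeries_C (a : ℍ[ℝ]) : conjSeries (PowerSeries.C a) = PowerSeries.C (star a) := by
  ext1 n
  rcases eq_or_ne n 0 with rfl | hn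
  · simp [conjSeries]
  · simp [conjSeries, PowerSeries.coeff_C, hn]

theorem conjSeries_X_sub_C (a : ℍ[ℝ]) :
    conjSeries (PowerSeries.X - PowerSeries.C a) = PowerSeries.X - PowerSeries.C (star a) := by
  ext1 n
  simp only [conjSeries, PowerSeries.coeff_mk, map_sub, PowerSeries.coeff_X, PowerSeries.coeff_C,
    star_sub]
  split_ifs <;> simp

/-- Conjugation puts the geometric factor on the left of `z - ᾱ`; multiplying by `1 - z α` shows the
order is immaterial. -/
theorem conjSeries_blaschkeFactor (α : ℍ[ℝ]) :
    conjSeries (blaschkeFactor α) = blaschkeFactor (star α) := by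
  have hg : conjSeries (PowerSeries.mk fun k => star α ^ k)
      = PowerSeries.mk fun k => star (star α) ^ k := by
    ext1 n
    simp [conjSeries]
  rw [blaschkeFactor, conjSeries_mul, conjSeries_X_sub_C, hg]
  refine (isUnit_blaschkeDenom (star α)).mul_left_cancel ?_
  rw [← mul_assoc, blaschkeDenom_mul_geometric, one_mul, blaschkeDenom_mul_blaschkeFactor]

theorem leftEval_conjSeries_star (f : PowerSeries ℍ[ℝ]) (γ : ℍ[ℝ]) :
    leftEval (conjSeries f) (star γ) = star (rightEval f γ) := by
  rw [leftEval, rightEval, tsum_star]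
  simp [conjSeries]

theorem tendsto_rightEval_iff (f : PowerSeries ℍ[ℝ]) :
    Tendsto (fun γ : ℍ[ℝ] => ‖rightEval f γ‖) normToOneLeft (𝓝 1) ↔
      Tendsto (fun γ : ℍ[ℝ] => ‖leftEval (conjSeries f) γ‖) normToOneLeft (𝓝 1) := by
  have hstar : Tendsto (star : ℍ[ℝ] → ℍ[ℝ]) normToOneLeft normToOneLeft :=
    tendsto_normToOneLeft_of_norm_eq norm_star
  constructor <;> intro h
  · refine (h.comp hstar).congr fun γ => ?_
    rw [Function.comp, ← norm_star, ← leftEval_conjSeries_star, star_star]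
  · refine (h.comp hstar).congr fun γ => ?_
    rw [Function.comp, leftEval_conjSeries_star, norm_star]

theorem DiscSummable.conjSeries {f : PowerSeries ℍ[ℝ]} (hf : DiscSummable f) :
    DiscSummable (conjSeries f) := by
  intro r hr0 hr1
  simpa [QuaternionicBlaschke.conjSeries] using hf r hr0 hr1

theorem IsFiniteBlaschkeProduct.isLeftInner_conjSeries {f : PowerSeries ℍ[ℝ]}
    (hf : IsFiniteBlaschkeProduct f) : IsLeftInner (conjSeries f) := by
  obtain ⟨l, φ, hl, hφ, rfl⟩ := hf
  rw [conjSeries_mul, conjSeries_C]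
  refine (isLeftInner_C (by simpa using hφ)).mul ?_
  induction l with
  | nil =>
    rw [List.map_nil, List.prod_nil, ← map_one PowerSeries.C, conjSeries_C]
    exact isLeftInner_C (by simp)
  | cons α l ih =>
    rw [List.map_cons, List.prod_cons, conjSeries_mul, conjSeries_blaschkeFactor]
    exact (ih fun a ha => hl a (List.mem_cons_of_mem _ ha)).mul
      (isLeftInner_blaschkeFactor (by simpa using hl α List.mem_cons_self))

/-- Each direction passes through the factorization, applied to `f` or to its conjugate series;
conjugation is an involution. -/
theorem tendsto_leftEval_iff_tendsto_rightEval {f : PowerSeries ℍ[ℝ]} (hs : DiscSummable f) :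
    Tendsto (fun γ : ℍ[ℝ] => ‖leftEval f γ‖) normToOneLeft (𝓝 1) ↔
      Tendsto (fun γ : ℍ[ℝ] => ‖rightEval f γ‖) normToOneLeft (𝓝 1) := by
  rw [tendsto_rightEval_iff]
  refine ⟨fun h => (IsLeftInner.isFiniteBlaschkeProduct ⟨hs, h⟩).isLeftInner_conjSeries.2,
    fun h => ?_⟩
  have h1 : IsLeftInner (conjSeries f) := ⟨hs.conjSeries, h⟩
  have h2 := h1.isFiniteBlaschkeProduct.isLeftInner_conjSeries.2
  rwa [conjSeries_conjSeries] at h2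

end QuaternionicBlaschke

end

theorem theorem3 (f : PowerSeries ℍ[ℝ]) (hf : f ∈ QuaternionicBlaschke.powerSeriesClass 1) :
    (Tendsto (fun γ : ℍ[ℝ] => ‖QuaternionicBlaschke.leftEval f γ‖)
        QuaternionicBlaschke.normToOneLeft (𝓝 (1 : ℝ)) →
      QuaternionicBlaschke.IsFiniteBlaschkeProduct f) ∧
    (Tendsto (fun γ : ℍ[ℝ] => ‖QuaternionicBlaschke.leftEval f γ‖)
        QuaternionicBlaschke.normToOneLeft (𝓝 (1 : ℝ)) ↔
      Tendsto (fun γ : ℍ[ℝ] => ‖QuaternionicBlaschke.rightEval f γ‖)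
        QuaternionicBlaschke.normToOneLeft (𝓝 (1 : ℝ))) := by
  have hs := QuaternionicBlaschke.discSummable_of_mem hf
  exact ⟨fun h => QuaternionicBlaschke.IsLeftInner.isFiniteBlaschkeProduct ⟨hs, h⟩,
    QuaternionicBlaschke.tendsto_leftEval_iff_tendsto_rightEval hs⟩
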